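/- Let $N\ge 1$, $K>0$ and $\Omega_1,\dots,\Omega_N\in\mathbb{R}$. For $\theta\in\mathbb{R}$ let $|\theta|_o:=|\bar\theta|$, where $\bar\theta\in(-\pi,\pi]$ and $\bar\theta\equiv\theta \pmod{2\pi}$. Consider the singular kernel in the critical regime $\alpha=\tfrac12$, $$h(\theta)=\frac{\sin\theta}{|\theta|_o^{2\alpha}}=\frac{\sin\theta}{|\theta|_o}\quad(\theta\notin 2\pi\mathbb{Z}),\qquad h(\theta)=0\quad(\theta\in 2\pi\mathbb{Z}),$$ which has jump discontinuities at the points of $2\pi\mathbb{Z}$, and the vector field $H=(H_1,\dots,H_N):\mathbb{R}^N\to\mathbb{R}^N$, $$H_i(\Theta)=\Omega_i+\frac{K}{N}\sum_{j=1}^N h(\theta_j-\theta_i),\qquad \Theta=(\theta_1,\dots,\theta_N).$$ Let $$\mathcal{H}(\Theta)=\bigcap_{\delta>0}\ \bigcap_{|\mathcal{N}|=0}\overline{\mathrm{co}}\big(H(B_\delta(\Theta)\setminus\mathcal{N})\big)$$ be its Filippov set-valued map, where $\mathcal{N}$ runs over the Lebesgue-null subsets of $\mathbb{R}^N$ and $\overline{\mathrm{co}}$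 denotes the closed convex hull. A Filippov solution on an interval $I$ of the system $\dot\theta_i=\Omega_i+\frac KN\sum_{j=1}^N h(\theta_j-\theta_i)$, $i=1,\dots,N$, is a map $\Theta:I\to\mathbb{R}^N$ that is absolutely continuous on every compact subinterval of $I$ and satisfies $\dot\Theta(t)\in\mathcal{H}(\Theta(t))$ for almost every $t\in I$. Then for every initial configuration $\Theta_0\in\mathbb{R}^N$ there is a global-in-time Filippov solution $\Theta:[0,\infty)\to\mathbb{R}^N$ with $\Theta(0)=\Theta_0$, and it is unique forward in time: every Filippov solution on $[0,\infty)$ or on $[0,T]$, for some $T\ge0$, with initial value $\Theta_0$ coincides with $\Theta$ on its interval of definition. -/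

import Mathlib

open MeasureTheory Set

noncomputable section

namespace SingularKuramoto

/-- The orthodromic distance to zero `|θ|ₒ`: the absolute value of the representative of `θ`
modulo `2π` in the interval `(-π, π]`. -/
def orthoDist (θ : ℝ) : ℝ := |(θ : Real.Angle).toReal|

/-- The singular interaction kernel `h(θ) = sin θ / |θ|ₒ ^ (2α)`. (For `α > 0` its value on `2πℤ`
is `0` by the convention `x / 0 = 0`.) -/
def kernel (α θ : ℝ) : ℝ := Real.sin θ / orthoDist θ ^ (2 * α)

/-- The vector field of the singular Kuramoto system,
`H_i(Θ) = Ω_i + (K / N) ∑_j h(θ_j - θ_i)`. -/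
def vectorField {N : ℕ} (α K : ℝ) (Ω : Fin N → ℝ) (Θ : EuclideanSpace ℝ (Fin N)) :
    EuclideanSpace ℝ (Fin N) :=
  WithLp.toLp 2 fun i => Ω i + K / N * ∑ j, kernel α (Θ j - Θ i)

/-- The Filippov set-valued map of `F : ℝ^N → ℝ^N`: the intersection, over all radii `δ > 0` and
all Lebesgue-null sets `Z`, of the closed convex hulls of `F (B_δ(x) \ Z)`. -/
def filippovMap {N : ℕ} (F : EuclideanSpace ℝ (Fin N) → EuclideanSpace ℝ (Fin N))
    (x : EuclideanSpace ℝ (Fin N)) : Set (EuclideanSpace ℝ (Fin N)) :=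
  ⋂ (δ : ℝ) (_ : 0 < δ) (Z : Set (EuclideanSpace ℝ (Fin N))) (_ : volume Z = 0),
    closure (convexHull ℝ (F '' (Metric.ball x δ \ Z)))

/-- `x` is a Filippov solution of `ẋ = F(x)` on the time interval `I`: it is absolutely continuous
on every compact subinterval of `I`, and at almost every time in (the interior of) `I` it is
differentiable with `ẋ(t)` in the value at `x(t)` of the Filippov map of `F`. -/
structure IsFilippovSolutionOn {N : ℕ}
    (F : EuclideanSpace ℝ (Fin N) → EuclideanSpace ℝ (Fin N))
    (x : ℝ → EuclideanSpace ℝ (Fin N)) (I : Set ℝ) : Prop where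
  absolutelyContinuous : ∀ a b : ℝ, a ≤ b → Icc a b ⊆ I → AbsolutelyContinuousOnInterval x a b
  deriv_mem : ∀ᵐ t : ℝ, t ∈ interior I → ∃ v ∈ filippovMap F (x t), HasDerivAt x v t

end SingularKuramoto

end

/-!
The critical Kuramoto kernel `h(θ) = sin θ / |θ|ₒ` is Lipschitz between consecutive points of
`2πℤ` and jumps *upwards*, from `-1` to `1`, at each of them; hence `h(θ) + 2 θ` is nondecreasing
(`monotone_kernel_half_add_two_mul`). As `h` is odd, exchanging the two particles in each pair
shows that the vector field `H`, though discontinuous, is one-sided Lipschitz: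
`⟪H x - H y, x - y⟫ ≤ 4 K ‖x - y‖²` (`inner_vectorField_half_sub_le`). It is also bounded. These
two properties alone give existence and uniqueness.

The one-sided Lipschitz estimate extends to all values `v`, `w` of the Filippov map at `x`, `y`
(`inner_sub_le_of_mem_filippovMap`): along two Filippov solutions the squared distance is
absolutely continuous and satisfies `(‖x - y‖²)' ≤ 2 L ‖x - y‖²` almost everywhere, so Grönwall's
inequality yields uniqueness (`eq_of_isFilippovSolutionOn_Icc`).

For existence, choose a value `v(x)` of the Filippov map at every point, which is possible by
compactness (`filippovMap_nonempty`), and follow the Euler polygons of the (arbitrary, perhaps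
non-measurable) field `v`. The same Grönwall estimate, with an error governed by the steps, shows
that they form a Cauchy sequence (`norm_eulerCurve_sub_eulerCurve_sq_le`). The limit is Lipschitz,
and its difference quotients are limits of averages of Euler velocities, so they lie in the closed
convex sets defining the Filippov map (`mem_filippovMap_of_tendsto_eulerCurve`).
-/

open Filter Topology
open scoped RealInnerProductSpace NNReal

namespace SingularKuramoto

/-! ### A Grönwall inequality for absolutely continuous functions -/

lemma absolutelyContinuousOnInterval_norm {E : Type*} [NormedAddCommGroup E] {f : ℝ → E} {a b : ℝ}
    (hf : AbsolutelyContinuousOnInterval f a b) :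
    AbsolutelyContinuousOnInterval (fun t => ‖f t‖) a b := by
  unfold AbsolutelyContinuousOnInterval at hf ⊢
  exact squeeze_zero (fun _ => Finset.sum_nonneg fun _ _ => dist_nonneg)
    (fun _ => Finset.sum_le_sum fun _ _ =>
      (dist_norm_norm_le _ _).trans_eq (dist_eq_norm _ _).symm) hf

/-- Grönwall's inequality when the differential inequality holds only almost everywhere: absolute
continuity makes `exp (-c t) * g t` the integral of its derivative, which is at most `ε`. -/
lemma gronwall_of_absolutelyContinuous {g : ℝ → ℝ} {c ε T : ℝ} (hc : 0 ≤ c) (hε : 0 ≤ ε)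
    (hT : 0 ≤ T) (hg : AbsolutelyContinuousOnInterval g 0 T)
    (h : ∀ᵐ t : ℝ, t ∈ Ioo 0 T → ∃ d, HasDerivAt g d t ∧ d ≤ c * g t + ε) :
    g T ≤ Real.exp (c * T) * (g 0 + ε * T) := by
  have hexp : AbsolutelyContinuousOnInterval (fun t => Real.exp (-c * t)) 0 T :=
    ContDiffOn.absolutelyContinuousOnInterval (by fun_prop)
  have hf := hexp.mul hg
  set f : ℝ → ℝ := (fun t => Real.exp (-c * t)) * g with hfdef
  have hint := hf.integral_deriv_eq_sub
  have hle : ∫ t in (0 : ℝ)..T, deriv f t ≤ ∫ _ in (0 : ℝ)..T, ε := by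
    refine intervalIntegral.integral_mono_ae_restrict hT hf.intervalIntegrable_deriv
      intervalIntegrable_const ?_
    rw [EventuallyLE, ← restrict_Ioo_eq_restrict_Icc, ae_restrict_iff' measurableSet_Ioo]
    filter_upwards [h] with t ht htm
    obtain ⟨d, hd, hdle⟩ := ht htm
    have he : HasDerivAt (fun t => Real.exp (-c * t)) (Real.exp (-c * t) * (-c)) t := by
      simpa using ((hasDerivAt_id t).const_mul (-c)).exp
    rw [(he.mul hd).deriv]
    have h1 : Real.exp (-c * t) ≤ 1 :=
      Real.exp_le_one_iff.2 (by nlinarith [mul_nonneg hc htm.1.le])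
    have h0 := Real.exp_pos (-c * t)
    nlinarith
  rw [hint, intervalIntegral.integral_const] at hle
  simp only [hfdef, Pi.mul_apply, mul_zero, Real.exp_zero, one_mul, sub_zero, smul_eq_mul] at hle
  have h2 : Real.exp (-c * T) * g T ≤ g 0 + ε * T := by linarith
  calc g T = Real.exp (c * T) * (Real.exp (-c * T) * g T) := by
        rw [← mul_assoc, ← Real.exp_add]; simp
    _ ≤ _ := mul_le_mul_of_nonneg_left h2 (Real.exp_pos _).le

/-- Two absolutely continuous curves whose velocities satisfy, almost everywhere, a one-sided
Lipschitz estimate up to an error `ε` stay close to each other. -/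
lemma norm_sub_sq_le_of_inner_le {E : Type*} [NormedAddCommGroup E] [InnerProductSpace ℝ E]
    {x y : ℝ → E} {c ε T : ℝ} (hc : 0 ≤ c) (hε : 0 ≤ ε) (hT : 0 ≤ T)
    (hx : AbsolutelyContinuousOnInterval x 0 T) (hy : AbsolutelyContinuousOnInterval y 0 T)
    (h0 : x 0 = y 0)
    (h : ∀ᵐ t : ℝ, t ∈ Ioo 0 T → ∃ v w, HasDerivAt x v t ∧ HasDerivAt y w t ∧
      ⟪v - w, x t - y t⟫ ≤ c * ‖x t - y t‖ ^ 2 + ε) :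
    ‖x T - y T‖ ^ 2 ≤ Real.exp (2 * c * T) * (2 * ε * T) := by
  have hn := absolutelyContinuousOnInterval_norm (hx.sub hy)
  have hg : AbsolutelyContinuousOnInterval (fun t => ‖x t - y t‖ ^ 2) 0 T := by
    simp only [pow_two]
    exact hn.mul hn
  have := gronwall_of_absolutelyContinuous (c := 2 * c) (ε := 2 * ε) (by positivity)
    (by positivity) hT hg ?_
  · simpa [h0] using this
  filter_upwards [h] with t ht htm
  obtain ⟨v, w, hv, hw, hvw⟩ := ht htm
  refine ⟨_, (hv.sub hw).norm_sq, ?_⟩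
  rw [real_inner_comm]
  simp only [Pi.sub_apply]
  linarith

/-! ### The Filippov map of a bounded one-sided Lipschitz field -/

section FilippovMap

variable {N : ℕ} {F : EuclideanSpace ℝ (Fin N) → EuclideanSpace ℝ (Fin N)} {L M : ℝ}

lemma filippovMap_subset {x : EuclideanSpace ℝ (Fin N)} {δ : ℝ} (hδ : 0 < δ)
    {Z : Set (EuclideanSpace ℝ (Fin N))} (hZ : volume Z = 0) :
    filippovMap F x ⊆ closure (convexHull ℝ (F '' (Metric.ball x δ \ Z))) :=
  fun _ hv => mem_iInter₂.1 (mem_iInter₂.1 hv δ hδ) Z hZ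

lemma filippovMap_subset_of_forall_mem {x : EuclideanSpace ℝ (Fin N)} {δ : ℝ} (hδ : 0 < δ)
    {C : Set (EuclideanSpace ℝ (Fin N))} (hC : Convex ℝ C) (hC' : IsClosed C)
    (h : ∀ a ∈ Metric.ball x δ, F a ∈ C) : filippovMap F x ⊆ C := by
  refine (filippovMap_subset hδ (measure_empty (μ := volume))).trans ?_
  refine closure_minimal (convexHull_min ?_ hC) hC'
  rintro _ ⟨a, ha, rfl⟩
  exact h a ha.1

lemma norm_le_of_mem_filippovMap (hM : ∀ a, ‖F a‖ ≤ M) {x v : EuclideanSpace ℝ (Fin N)}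
    (hv : v ∈ filippovMap F x) : ‖v‖ ≤ M := by
  simpa using filippovMap_subset_of_forall_mem one_pos (convex_closedBall 0 M)
    Metric.isClosed_closedBall (fun a _ => by simpa using hM a) hv

lemma inner_le_of_mem_filippovMap {x v e : EuclideanSpace ℝ (Fin N)} {δ c : ℝ} (hδ : 0 < δ)
    (h : ∀ a ∈ Metric.ball x δ, ⟪F a, e⟫ ≤ c) (hv : v ∈ filippovMap F x) : ⟪v, e⟫ ≤ c := by
  refine filippovMap_subset_of_forall_mem (C := {u | ⟪u, e⟫ ≤ c}) hδ ?_ ?_ h hv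
  · refine convex_halfSpace_le ⟨fun u w => inner_add_left u w e, fun r u => ?_⟩ c
    rw [real_inner_smul_left, smul_eq_mul]
  · exact isClosed_le (by fun_prop) continuous_const

/-- The one-sided Lipschitz estimate passes from a bounded field to its Filippov map. -/
lemma inner_sub_le_of_mem_filippovMap (hL : 0 ≤ L) (hM : ∀ a, ‖F a‖ ≤ M)
    (hF : ∀ a b, ⟪F a - F b, a - b⟫ ≤ L * ‖a - b‖ ^ 2) {x y v w : EuclideanSpace ℝ (Fin N)}
    (hv : v ∈ filippovMap F x) (hw : w ∈ filippovMap F y) :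
    ⟪v - w, x - y⟫ ≤ L * ‖x - y‖ ^ 2 := by
  have key : ∀ δ > 0, ⟪v - w, x - y⟫ ≤ L * (‖x - y‖ + 2 * δ) ^ 2 + 4 * M * δ := by
    intro δ hδ
    have hab : ∀ a ∈ Metric.ball x δ, ∀ b ∈ Metric.ball y δ,
        ⟪F a, x - y⟫ - ⟪F b, x - y⟫ ≤ L * (‖x - y‖ + 2 * δ) ^ 2 + 4 * M * δ := by
      intro a ha b hb
      rw [mem_ball_iff_norm'] at ha hb
      have e1 : ⟪F a, x - y⟫ - ⟪F b, x - y⟫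
          = ⟪F a - F b, a - b⟫ + ⟪F a - F b, (x - a) - (y - b)⟫ := by
        rw [← inner_sub_left, ← inner_add_right]; congr 1; abel
      have e2 : ‖(x - a) - (y - b)‖ ≤ 2 * δ := (norm_sub_le _ _).trans (by linarith)
      have e3 : ‖a - b‖ ≤ ‖x - y‖ + 2 * δ := by
        calc ‖a - b‖ = ‖(x - y) - ((x - a) - (y - b))‖ := by congr 1; abel
          _ ≤ _ := (norm_sub_le _ _).trans (by linarith)
      have e4 : ‖F a - F b‖ ≤ 2 * M := (norm_sub_le _ _).trans (by linarith [hM a, hM b])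
      have e5 : ⟪F a - F b, (x - a) - (y - b)⟫ ≤ 2 * M * (2 * δ) :=
        (real_inner_le_norm _ _).trans
          (mul_le_mul e4 e2 (norm_nonneg _) ((norm_nonneg _).trans e4))
      have e6 : L * ‖a - b‖ ^ 2 ≤ L * (‖x - y‖ + 2 * δ) ^ 2 := by gcongr
      linarith [hF a b]
    set c := L * (‖x - y‖ + 2 * δ) ^ 2 + 4 * M * δ
    have h1 : ∀ b ∈ Metric.ball y δ, ⟪v, x - y⟫ ≤ ⟪F b, x - y⟫ + c := fun b hb =>
      inner_le_of_mem_filippovMap hδ (fun a ha => by linarith [hab a ha b hb]) hv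
    have h2 : ⟪w, -(x - y)⟫ ≤ c - ⟪v, x - y⟫ :=
      inner_le_of_mem_filippovMap hδ
        (fun b hb => by rw [inner_neg_right]; linarith [h1 b hb]) hw
    rw [inner_neg_right] at h2
    rw [inner_sub_left]
    linarith
  have hlim : Tendsto (fun δ : ℝ => L * (‖x - y‖ + 2 * δ) ^ 2 + 4 * M * δ) (𝓝[>] 0)
      (𝓝 (L * ‖x - y‖ ^ 2)) := by
    have : Continuous fun δ : ℝ => L * (‖x - y‖ + 2 * δ) ^ 2 + 4 * M * δ := by fun_prop
    simpa using (this.tendsto 0).mono_left nhdsWithin_le_nhds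
  exact ge_of_tendsto hlim (eventually_mem_nhdsWithin.mono key)

/-- For a bounded field the Filippov map has nonempty values: they are directed intersections of
nonempty compact sets. -/
lemma filippovMap_nonempty (hM : ∀ a, ‖F a‖ ≤ M) (x : EuclideanSpace ℝ (Fin N)) :
    (filippovMap F x).Nonempty := by
  let ι := {δ : ℝ // 0 < δ} × {Z : Set (EuclideanSpace ℝ (Fin N)) // volume Z = 0}
  let t : ι → Set (EuclideanSpace ℝ (Fin N)) := fun i =>
    closure (convexHull ℝ (F '' (Metric.ball x i.1 \ i.2)))
  have : Nonempty ι := ⟨⟨1, one_pos⟩, ⟨∅, measure_empty⟩⟩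
  have hsub : ∀ i, t i ⊆ Metric.closedBall 0 M := by
    refine fun i => closure_minimal (convexHull_min ?_ (convex_closedBall 0 M))
      Metric.isClosed_closedBall
    rintro _ ⟨a, -, rfl⟩
    simpa using hM a
  have hne : (⋂ i, t i).Nonempty := by
    refine IsCompact.nonempty_iInter_of_directed_nonempty_isCompact_isClosed t ?_ ?_
      (fun i => (isCompact_closedBall 0 M).of_isClosed_subset isClosed_closure (hsub i))
      (fun _ => isClosed_closure)
    · intro i j
      refine ⟨⟨⟨min i.1 j.1, lt_min i.1.2 j.1.2⟩,
        ⟨i.2 ∪ j.2, measure_union_null i.2.2 j.2.2⟩⟩, ?_, ?_⟩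
      · exact closure_mono (convexHull_mono (image_mono
          (sdiff_subset_sdiff (Metric.ball_subset_ball (min_le_left _ _)) subset_union_left)))
      · exact closure_mono (convexHull_mono (image_mono
          (sdiff_subset_sdiff (Metric.ball_subset_ball (min_le_right _ _)) subset_union_right)))
    · intro i
      refine ((Set.Nonempty.image F ?_).convexHull (𝕜 := ℝ)).closure
      refine nonempty_of_measure_ne_zero (μ := volume) ?_
      rw [measure_sdiff_null i.2.2]
      exact (Metric.measure_ball_pos volume x i.1.2).ne'
  refine hne.mono fun v hv => ?_
  simp only [filippovMap, mem_iInter]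
  exact fun δ hδ Z hZ => mem_iInter.1 hv ⟨⟨δ, hδ⟩, ⟨Z, hZ⟩⟩

/-- Filippov solutions of a bounded one-sided Lipschitz field are determined by their initial
value. -/
lemma eq_of_isFilippovSolutionOn_Icc (hL : 0 ≤ L) (hM : ∀ a, ‖F a‖ ≤ M)
    (hF : ∀ a b, ⟪F a - F b, a - b⟫ ≤ L * ‖a - b‖ ^ 2) {T : ℝ} (hT : 0 ≤ T)
    {x y : ℝ → EuclideanSpace ℝ (Fin N)} (hx : IsFilippovSolutionOn F x (Icc 0 T))
    (hy : IsFilippovSolutionOn F y (Icc 0 T)) (h0 : x 0 = y 0) : x T = y T := by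
  have := norm_sub_sq_le_of_inner_le (ε := 0) hL le_rfl hT
    (hx.absolutelyContinuous 0 T hT subset_rfl) (hy.absolutelyContinuous 0 T hT subset_rfl) h0 ?_
  · rw [mul_zero, zero_mul, mul_zero] at this
    exact sub_eq_zero.1 (norm_eq_zero.1 (pow_eq_zero_iff two_ne_zero |>.1
      (le_antisymm this (sq_nonneg _))))
  filter_upwards [hx.deriv_mem, hy.deriv_mem] with t htx hty ht
  rw [interior_Icc] at htx hty
  obtain ⟨v, hv, hv'⟩ := htx ht
  obtain ⟨w, hw, hw'⟩ := hty ht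
  exact ⟨v, w, hv', hw', by simpa using inner_sub_le_of_mem_filippovMap hL hM hF hv hw⟩

lemma IsFilippovSolutionOn.mono {x : ℝ → EuclideanSpace ℝ (Fin N)} {I J : Set ℝ}
    (hx : IsFilippovSolutionOn F x I) (h : J ⊆ I) : IsFilippovSolutionOn F x J where
  absolutelyContinuous a b hab hJ := hx.absolutelyContinuous a b hab (hJ.trans h)
  deriv_mem := hx.deriv_mem.mono fun _ ht htJ => ht (interior_mono h htJ)

end FilippovMap

/-! ### Euler polygons -/

section Euler

variable {E : Type*} [NormedAddCommGroup E] [NormedSpace ℝ E]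

/-- The nodes of the explicit Euler scheme with step `h` for the field `v`, starting at `x₀`. -/
def eulerNode (v : E → E) (x₀ : E) (h : ℝ) : ℕ → E
  | 0 => x₀
  | k + 1 => eulerNode v x₀ h k + h • v (eulerNode v x₀ h k)

/-- The last node of the Euler scheme reached by time `t` (the initial one if `t < 0`). -/
noncomputable def lastNode (v : E → E) (x₀ : E) (h t : ℝ) : E :=
  eulerNode v x₀ h ⌊t / h⌋₊

/-- The Euler polygon, written as the integral of its piecewise constant velocity. -/
noncomputable def eulerCurve (v : E → E) (x₀ : E) (h t : ℝ) : E :=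
  x₀ + ∫ s in (0 : ℝ)..t, v (lastNode v x₀ h s)

variable {v : E → E} {x₀ : E} {h M : ℝ}

lemma eulerCurve_zero : eulerCurve v x₀ h 0 = x₀ := by simp [eulerCurve]

lemma stronglyMeasurable_eulerVelocity : StronglyMeasurable fun s => v (lastNode v x₀ h s) := by
  have h1 : StronglyMeasurable fun k : ℕ => v (eulerNode v x₀ h k) := .of_discrete
  exact h1.comp_measurable (Nat.measurable_floor.comp (measurable_id.div_const h))

lemma intervalIntegrable_eulerVelocity (hM : ∀ x, ‖v x‖ ≤ M) (a b : ℝ) :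
    IntervalIntegrable (fun s => v (lastNode v x₀ h s)) volume a b :=
  (intervalIntegrable_const (c := M)).mono_fun'
    stronglyMeasurable_eulerVelocity.aestronglyMeasurable (ae_of_all _ fun _ => hM _)

lemma eulerCurve_sub (hM : ∀ x, ‖v x‖ ≤ M) (s t : ℝ) :
    eulerCurve v x₀ h t - eulerCurve v x₀ h s = ∫ r in s..t, v (lastNode v x₀ h r) := by
  rw [eulerCurve, eulerCurve, add_sub_add_left_eq_sub, intervalIntegral.integral_interval_sub_left
    (intervalIntegrable_eulerVelocity hM _ _) (intervalIntegrable_eulerVelocity hM _ _)]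

lemma norm_eulerCurve_sub_le (hM : ∀ x, ‖v x‖ ≤ M) (s t : ℝ) :
    ‖eulerCurve v x₀ h t - eulerCurve v x₀ h s‖ ≤ M * |t - s| := by
  rw [eulerCurve_sub hM]
  exact intervalIntegral.norm_integral_le_of_norm_le_const fun _ _ => hM _

lemma lipschitzWith_eulerCurve (hM : ∀ x, ‖v x‖ ≤ M) :
    LipschitzWith M.toNNReal (eulerCurve v x₀ h) := by
  have hM0 : 0 ≤ M := (norm_nonneg _).trans (hM x₀)
  refine LipschitzWith.of_dist_le_mul fun s t => ?_
  rw [dist_eq_norm, Real.dist_eq, Real.coe_toNNReal _ hM0]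
  exact norm_eulerCurve_sub_le hM _ _

variable [CompleteSpace E]

lemma eulerCurve_node (hh : 0 < h) (hM : ∀ x, ‖v x‖ ≤ M) (k : ℕ) :
    eulerCurve v x₀ h (k * h) = eulerNode v x₀ h k := by
  induction k with
  | zero => simp [eulerCurve_zero, eulerNode]
  | succ k ih =>
    have h1 : ∫ r in (k * h)..((k + 1 : ℕ) * h), v (lastNode v x₀ h r)
        = ∫ _ in (k * h)..((k + 1 : ℕ) * h), v (eulerNode v x₀ h k) := by
      refine intervalIntegral.integral_congr_ae ?_
      -- the velocity takes its next value at the right end point, which is a null set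
      filter_upwards [Measure.ae_ne volume (((k + 1 : ℕ) : ℝ) * h)] with r hr hmem
      rw [uIoc_of_le (by push_cast; nlinarith)] at hmem
      have hlt := lt_of_le_of_ne hmem.2 hr
      have : ⌊r / h⌋₊ = k := by
        rw [Nat.floor_eq_iff (div_nonneg ((by positivity : 0 ≤ k * h).trans hmem.1.le) hh.le),
          le_div_iff₀ hh, div_lt_iff₀ hh]
        exact ⟨hmem.1.le, by exact_mod_cast hlt⟩
      rw [lastNode, this]
    have h2 := eulerCurve_sub (x₀ := x₀) (h := h) hM (k * h) ((k + 1 : ℕ) * h)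
    rw [h1, intervalIntegral.integral_const, ih, sub_eq_iff_eq_add'] at h2
    rw [h2, eulerNode]
    congr 2
    push_cast
    ring

lemma norm_lastNode_sub_eulerCurve_le (hh : 0 < h) (hM : ∀ x, ‖v x‖ ≤ M) {t : ℝ} (ht : 0 ≤ t) :
    ‖lastNode v x₀ h t - eulerCurve v x₀ h t‖ ≤ M * h := by
  have hM0 : 0 ≤ M := (norm_nonneg _).trans (hM x₀)
  rw [lastNode, ← eulerCurve_node hh hM]
  refine (norm_eulerCurve_sub_le hM _ _).trans (mul_le_mul_of_nonneg_left ?_ hM0)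
  have h1 := Nat.floor_le (div_nonneg ht hh.le)
  have h2 := Nat.lt_floor_add_one (t / h)
  rw [le_div_iff₀ hh] at h1
  rw [div_lt_iff₀ hh] at h2
  rw [abs_le]
  constructor <;> linarith

lemma ae_hasDerivAt_eulerCurve (hM : ∀ x, ‖v x‖ ≤ M) (T : ℝ) :
    ∀ᵐ t : ℝ, t ∈ Ioo 0 T → HasDerivAt (eulerCurve v x₀ h) (v (lastNode v x₀ h t)) t := by
  filter_upwards [(intervalIntegrable_eulerVelocity (x₀ := x₀) (h := h) hM 0
    T).ae_hasDerivAt_integral] with t ht htm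
  have hle := (htm.1.trans htm.2).le
  exact (ht (uIcc_of_le hle ▸ Ioo_subset_Icc_self htm) 0 left_mem_uIcc).const_add x₀

end Euler

/-- Two Euler polygons for a bounded one-sided Lipschitz field differ by an amount controlled by
their steps. -/
lemma norm_eulerCurve_sub_eulerCurve_sq_le {E : Type*} [NormedAddCommGroup E]
    [InnerProductSpace ℝ E] [CompleteSpace E] {v : E → E} {x₀ : E} {h h' L M T : ℝ}
    (hL : 0 ≤ L) (hM : ∀ x, ‖v x‖ ≤ M)
    (hv : ∀ a b, ⟪v a - v b, a - b⟫ ≤ L * ‖a - b‖ ^ 2) (hh : 0 < h) (hh' : 0 < h') (hT : 0 ≤ T) :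
    ‖eulerCurve v x₀ h T - eulerCurve v x₀ h' T‖ ^ 2 ≤ Real.exp (2 * (2 * L) * T) *
      (2 * (2 * L * (M * (h + h')) ^ 2 + 2 * M * (M * (h + h'))) * T) := by
  have hM0 : 0 ≤ M := (norm_nonneg _).trans (hM x₀)
  refine norm_sub_sq_le_of_inner_le (by positivity) (by positivity) hT
    (lipschitzWith_eulerCurve hM).lipschitzOnWith.absolutelyContinuousOnInterval
    (lipschitzWith_eulerCurve hM).lipschitzOnWith.absolutelyContinuousOnInterval
    (by rw [eulerCurve_zero, eulerCurve_zero]) ?_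
  filter_upwards [ae_hasDerivAt_eulerCurve (x₀ := x₀) (h := h) hM T,
    ae_hasDerivAt_eulerCurve (x₀ := x₀) (h := h') hM T] with t ht ht' htm
  refine ⟨_, _, ht htm, ht' htm, ?_⟩
  have n1 := norm_lastNode_sub_eulerCurve_le (x₀ := x₀) hh hM htm.1.le
  have n2 := norm_lastNode_sub_eulerCurve_le (x₀ := x₀) hh' hM htm.1.le
  set p := eulerCurve v x₀ h t
  set p' := eulerCurve v x₀ h' t
  set q := lastNode v x₀ h t
  set q' := lastNode v x₀ h' t
  have e0 : ‖(q - p) - (q' - p')‖ ≤ M * (h + h') := (norm_sub_le _ _).trans (by linarith)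
  have e1 : ⟪v q - v q', p - p'⟫ = ⟪v q - v q', q - q'⟫ - ⟪v q - v q', (q - p) - (q' - p')⟫ := by
    rw [← inner_sub_right]; congr 1; abel
  have e2 : ‖q - q'‖ ≤ ‖p - p'‖ + M * (h + h') := by
    calc ‖q - q'‖ = ‖(p - p') + ((q - p) - (q' - p'))‖ := by congr 1; abel
      _ ≤ _ := (norm_add_le _ _).trans (by linarith)
  have e3 : ‖v q - v q'‖ ≤ 2 * M := (norm_sub_le _ _).trans (by linarith [hM q, hM q'])
  have e4 : |⟪v q - v q', (q - p) - (q' - p')⟫| ≤ 2 * M * (M * (h + h')) :=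
    (abs_real_inner_le_norm _ _).trans
      (mul_le_mul e3 e0 (norm_nonneg _) ((norm_nonneg _).trans e3))
  have e5 : L * ‖q - q'‖ ^ 2 ≤ L * (2 * ‖p - p'‖ ^ 2 + 2 * (M * (h + h')) ^ 2) := by
    refine mul_le_mul_of_nonneg_left ?_ hL
    refine (pow_le_pow_left₀ (norm_nonneg _) e2 2).trans ?_
    nlinarith [sq_nonneg (‖p - p'‖ - M * (h + h'))]
  linarith [hv q q', neg_abs_le ⟪v q - v q', (q - p) - (q' - p')⟫]

/-! ### Existence of Filippov solutions -/

/-- The Euler polygons with steps `1 / (n + 1)` converge at every nonnegative time. -/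
lemma exists_tendsto_eulerCurve {E : Type*} [NormedAddCommGroup E]
    [InnerProductSpace ℝ E] [CompleteSpace E] {v : E → E} (x₀ : E) {L M t : ℝ}
    (hL : 0 ≤ L) (hM : ∀ x, ‖v x‖ ≤ M)
    (hv : ∀ a b, ⟪v a - v b, a - b⟫ ≤ L * ‖a - b‖ ^ 2) (ht : 0 ≤ t) :
    ∃ l, Tendsto (fun n : ℕ => eulerCurve v x₀ (1 / ((n : ℝ) + 1)) t) atTop (𝓝 l) := by
  refine cauchySeq_tendsto_of_complete ?_
  rw [cauchySeq_iff_tendsto_dist_atTop_0]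
  have hstep : Tendsto (fun z : ℕ × ℕ => 1 / ((z.1 : ℝ) + 1) + 1 / ((z.2 : ℝ) + 1)) atTop
      (𝓝 0) := by
    rw [← prod_atTop_atTop_eq]
    simpa using (tendsto_one_div_add_atTop_nhds_zero_nat (𝕜 := ℝ)).comp tendsto_fst |>.add
      ((tendsto_one_div_add_atTop_nhds_zero_nat (𝕜 := ℝ)).comp tendsto_snd)
  have hcont : Continuous fun r : ℝ => √(Real.exp (2 * (2 * L) * t) *
      (2 * (2 * L * (M * r) ^ 2 + 2 * M * (M * r)) * t)) := by fun_prop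
  have hlim := (hcont.tendsto 0).comp hstep
  simp only [mul_zero, ne_eq, OfNat.ofNat_ne_zero, not_false_eq_true, zero_pow, add_zero,
    zero_mul, Real.sqrt_zero] at hlim
  refine squeeze_zero (fun _ => dist_nonneg) (fun z => ?_) hlim
  rw [dist_eq_norm]
  refine Real.le_sqrt_of_sq_le ?_
  exact norm_eulerCurve_sub_eulerCurve_sq_le hL hM hv (by positivity) (by positivity) ht

section Existence

variable {N : ℕ} {F : EuclideanSpace ℝ (Fin N) → EuclideanSpace ℝ (Fin N)} {L M : ℝ}

/-- A limit of Euler polygons for a selection `v` of the Filippov map moves, at each time where it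
is differentiable, with a velocity in the Filippov map. On a short time interval the polygons of
small step have velocities in the closed convex hull of `F (B_δ(x t) \ Z)`; so do their difference
quotients, being averages of velocities, and the limits of these. -/
lemma mem_filippovMap_of_tendsto_eulerCurve
    {v : EuclideanSpace ℝ (Fin N) → EuclideanSpace ℝ (Fin N)}
    (hv : ∀ a, v a ∈ filippovMap F a) (hM : ∀ a, ‖v a‖ ≤ M) {x₀ : EuclideanSpace ℝ (Fin N)}
    {x : ℝ → EuclideanSpace ℝ (Fin N)}
    (hx : ∀ t, 0 ≤ t → Tendsto (fun n : ℕ => eulerCurve v x₀ (1 / ((n : ℝ) + 1)) t) atTop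
      (𝓝 (x t)))
    {t : ℝ} (ht : 0 < t) {d : EuclideanSpace ℝ (Fin N)} (hd : HasDerivAt x d t) :
    d ∈ filippovMap F (x t) := by
  have hM0 : 0 ≤ M := (norm_nonneg _).trans (hM x₀)
  simp only [filippovMap, mem_iInter]
  intro δ hδ Z hZ
  set C := closure (convexHull ℝ (F '' (Metric.ball (x t) δ \ Z))) with hC
  have hconv : Convex ℝ C := (convex_convexHull ℝ _).closure
  have hball : ∀ q, ‖q - x t‖ < δ / 2 → v q ∈ C := by
    intro q hq
    refine closure_mono (convexHull_mono (image_mono (sdiff_subset_sdiff_left ?_)))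
      (filippovMap_subset (half_pos hδ) hZ (hv q))
    exact Metric.ball_subset_ball' (by rw [dist_eq_norm]; linarith)
  have hstep := tendsto_one_div_add_atTop_nhds_zero_nat (𝕜 := ℝ)
  have hmem : ∀ s, t < s → M * (s - t) < δ / 4 → (s - t)⁻¹ • (x s - x t) ∈ C := by
    intro s hs hsδ
    refine isClosed_closure.mem_of_tendsto
      (((hx s (ht.trans hs).le).sub (hx t ht.le)).const_smul (s - t)⁻¹) ?_
    have h1 : Tendsto (fun n : ℕ => M * (1 / ((n : ℝ) + 1)) +
        ‖eulerCurve v x₀ (1 / ((n : ℝ) + 1)) t - x t‖) atTop (𝓝 0) := by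
      simpa using (hstep.const_mul M).add ((hx t ht.le).sub_const (x t)).norm
    filter_upwards [h1.eventually_lt_const (show 0 < δ / 4 by positivity)] with n hn
    have hvel : ∀ r ∈ Ioc t s, v (lastNode v x₀ (1 / ((n : ℝ) + 1)) r) ∈ C := by
      intro r hr
      refine hball _ ?_
      -- `δ / 4` bounds the motion during `[t, s]`, another `δ / 4` the error at time `t` and the
      -- length of an Euler step
      have a1 := norm_lastNode_sub_eulerCurve_le (x₀ := x₀) (h := 1 / ((n : ℝ) + 1))
        (by positivity) hM (ht.trans hr.1).le
      have a2 := norm_eulerCurve_sub_le (x₀ := x₀) (h := 1 / ((n : ℝ) + 1)) hM t r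
      have a3 : M * |r - t| ≤ M * (s - t) := by
        rw [abs_of_pos (sub_pos.2 hr.1)]
        gcongr
        exact hr.2
      have a4 := norm_sub_le_norm_sub_add_norm_sub (lastNode v x₀ (1 / ((n : ℝ) + 1)) r)
        (eulerCurve v x₀ (1 / ((n : ℝ) + 1)) r) (x t)
      have a5 := norm_sub_le_norm_sub_add_norm_sub (eulerCurve v x₀ (1 / ((n : ℝ) + 1)) r)
        (eulerCurve v x₀ (1 / ((n : ℝ) + 1)) t) (x t)
      linarith
    have havg := hconv.set_average_mem isClosed_closure (μ := volume) (t := Ioc t s)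
      (by simpa using hs) (by simp) ((ae_restrict_iff' measurableSet_Ioc).2 (ae_of_all _ hvel))
      (intervalIntegrable_eulerVelocity hM t s).1
    rwa [← uIoc_of_le hs.le, interval_average_eq, ← eulerCurve_sub hM] at havg
  have hslope : Tendsto (slope x t) (𝓝[>] t) (𝓝 d) :=
    (hasDerivAt_iff_tendsto_slope.1 hd).mono_left (nhdsWithin_mono t fun s (hs : t < s) => hs.ne')
  refine isClosed_closure.mem_of_tendsto hslope ?_
  have h2 : Tendsto (fun s => M * (s - t)) (𝓝[>] t) (𝓝 0) := by
    have : Continuous fun s : ℝ => M * (s - t) := by fun_prop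
    simpa using (this.tendsto t).mono_left nhdsWithin_le_nhds
  filter_upwards [self_mem_nhdsWithin, h2.eventually_lt_const (show 0 < δ / 4 by positivity)]
    with s hs hs'
  exact hmem s hs hs'

/-- A bounded one-sided Lipschitz field has a global Filippov solution from every initial value. -/
lemma exists_isFilippovSolutionOn_Ici (hL : 0 ≤ L) (hM : ∀ a, ‖F a‖ ≤ M)
    (hF : ∀ a b, ⟪F a - F b, a - b⟫ ≤ L * ‖a - b‖ ^ 2) (x₀ : EuclideanSpace ℝ (Fin N)) :
    ∃ x, IsFilippovSolutionOn F x (Ici 0) ∧ x 0 = x₀ := by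
  choose v hv using filippovMap_nonempty hM
  have hvM : ∀ a, ‖v a‖ ≤ M := fun a => norm_le_of_mem_filippovMap hM (hv a)
  have hM0 : 0 ≤ M := (norm_nonneg _).trans (hM x₀)
  -- precomposing with `max · 0` yields a limit that is Lipschitz on the whole line
  choose x hx using fun t : ℝ => exists_tendsto_eulerCurve x₀ hL hvM
    (fun a b => inner_sub_le_of_mem_filippovMap hL hM hF (hv a) (hv b)) (le_max_right t 0)
  have hx' : ∀ t, 0 ≤ t → Tendsto (fun n : ℕ => eulerCurve v x₀ (1 / ((n : ℝ) + 1)) t) atTop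
      (𝓝 (x t)) := fun t ht => by simpa only [max_eq_left ht] using hx t
  have hlip : LipschitzWith M.toNNReal x := by
    refine LipschitzWith.of_dist_le_mul fun s t => ?_
    refine le_of_tendsto ((hx s).dist (hx t)) (Eventually.of_forall fun n => ?_)
    refine ((lipschitzWith_eulerCurve hvM).dist_le_mul _ _).trans ?_
    gcongr
    exact abs_max_sub_max_le_abs s t 0
  refine ⟨x, ⟨fun a b _ _ => hlip.lipschitzOnWith.absolutelyContinuousOnInterval, ?_⟩, ?_⟩
  · filter_upwards [hlip.ae_differentiableAt_real] with t hdiff ht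
    rw [interior_Ici] at ht
    exact ⟨_, mem_filippovMap_of_tendsto_eulerCurve hv hvM hx' ht hdiff.hasDerivAt,
      hdiff.hasDerivAt⟩
  · refine tendsto_nhds_unique (hx' 0 le_rfl) ?_
    simp only [eulerCurve_zero]
    exact tendsto_const_nhds

end Existence

/-! ### The critical Kuramoto field -/

lemma kernel_half (θ : ℝ) : kernel (1 / 2) θ = Real.sin θ / orthoDist θ := by
  simp [kernel]

lemma kernel_half_add_int_mul_two_pi (θ : ℝ) (n : ℤ) :
    kernel (1 / 2) (θ + n * (2 * Real.pi)) = kernel (1 / 2) θ := by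
  rw [kernel_half, kernel_half, Real.sin_add_int_mul_two_pi, orthoDist, orthoDist]
  congr 3
  rw [Real.Angle.angle_eq_iff_two_pi_dvd_sub]
  exact ⟨n, by ring⟩

lemma kernel_half_neg (θ : ℝ) : kernel (1 / 2) (-θ) = -kernel (1 / 2) θ := by
  rw [kernel_half, kernel_half, Real.sin_neg, orthoDist, orthoDist, Real.Angle.coe_neg,
    Real.Angle.abs_toReal_neg, neg_div]

lemma abs_kernel_half_le (θ : ℝ) : |kernel (1 / 2) θ| ≤ 1 := by
  have h : Real.sin θ = Real.sin (θ : Real.Angle).toReal := by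
    rw [Real.Angle.sin_toReal, Real.Angle.sin_coe]
  rw [kernel_half, orthoDist, abs_div, abs_abs, h]
  exact div_le_one_of_le₀ Real.abs_sin_le_abs (abs_nonneg _)

lemma kernel_half_of_nonneg_of_le_pi {θ : ℝ} (h0 : 0 ≤ θ) (h1 : θ ≤ Real.pi) :
    kernel (1 / 2) θ = Real.sin θ / θ := by
  rw [kernel_half, orthoDist, Real.Angle.abs_toReal_coe_eq_self_iff.2 ⟨h0, h1⟩]

/-- On `(0, π]` the derivative of `sin θ / θ + 2 θ` is nonnegative because
`sin θ ≤ θ` and `cos θ ≥ 1 - θ ^ 2 / 2`. -/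
lemma monotoneOn_sin_div_add_two_mul :
    MonotoneOn (fun θ : ℝ => Real.sin θ / θ + 2 * θ) (Ioc 0 Real.pi) := by
  have hd : ∀ θ : ℝ, θ ≠ 0 → HasDerivAt (fun θ : ℝ => Real.sin θ / θ + 2 * θ)
      ((Real.cos θ * θ - Real.sin θ * 1) / θ ^ 2 + 2 * 1) θ := fun θ hθ =>
    ((Real.hasDerivAt_sin θ).div (hasDerivAt_id θ) hθ).add ((hasDerivAt_id θ).const_mul 2)
  refine monotoneOn_of_deriv_nonneg (convex_Ioc _ _)
    (fun θ hθ => (hd θ hθ.1.ne').continuousAt.continuousWithinAt)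
    (fun θ hθ => ?_) (fun θ hθ => ?_)
  · rw [interior_Ioc] at hθ
    exact (hd θ hθ.1.ne').differentiableAt.differentiableWithinAt
  · rw [interior_Ioc] at hθ
    rw [(hd θ hθ.1.ne').deriv]
    have h1 := Real.sin_le hθ.1.le
    have h2 := Real.one_sub_sq_div_two_le_cos (x := θ)
    have h3 : θ ≤ 4 := hθ.2.le.trans Real.pi_le_four
    have h4 : 0 < θ ^ 2 := pow_pos hθ.1 2
    have : -2 ≤ (Real.cos θ * θ - Real.sin θ * 1) / θ ^ 2 := by
      rw [le_div_iff₀ h4]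
      nlinarith [mul_le_mul_of_nonneg_right h2 hθ.1.le, mul_nonneg h4.le (sub_nonneg.2 h3)]
    linarith

/-- The kernel jumps upwards at its discontinuities, so that adding `2 θ` makes it monotone on a
period. -/
lemma monotoneOn_kernel_half_add_two_mul :
    MonotoneOn (fun θ : ℝ => kernel (1 / 2) θ + 2 * θ) (Icc (-Real.pi) Real.pi) := by
  set g := fun θ : ℝ => kernel (1 / 2) θ + 2 * θ
  have hg0 : g 0 = 0 := by simp only [g, kernel_half]; simp
  refine (monotoneOn_iff_forall_lt).2 fun a ha b hb hab => ?_
  have hneg : ∀ θ, g (-θ) = - g θ := fun θ => by simp only [g, kernel_half_neg]; ring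
  have hpos : ∀ θ, 0 ≤ θ → θ ≤ Real.pi → 0 ≤ g θ := fun θ h0 h1 => by
    simp only [g]
    rw [kernel_half_of_nonneg_of_le_pi h0 h1]
    have := div_nonneg (Real.sin_nonneg_of_nonneg_of_le_pi h0 h1) h0
    linarith
  have hmono : ∀ c d, 0 < c → c ≤ d → d ≤ Real.pi → g c ≤ g d := fun c d h0 hcd h1 => by
    simp only [g]
    rw [kernel_half_of_nonneg_of_le_pi h0.le (hcd.trans h1),
      kernel_half_of_nonneg_of_le_pi (h0.le.trans hcd) h1]
    exact monotoneOn_sin_div_add_two_mul ⟨h0, hcd.trans h1⟩ ⟨h0.trans_le hcd, h1⟩ hcd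
  rcases lt_or_ge 0 a with h | h
  · exact hmono a b h hab.le hb.2
  rcases lt_or_ge b 0 with h' | h'
  · have := hmono (-b) (-a) (by linarith) (by linarith) (by linarith [ha.1])
    rw [hneg, hneg] at this
    linarith
  · have h1 := hpos b h' hb.2
    have h2 := hpos (-a) (by linarith) (by linarith [ha.1])
    rw [hneg] at h2
    linarith

lemma monotone_kernel_half_add_two_mul :
    Monotone (fun θ : ℝ => kernel (1 / 2) θ + 2 * θ) := by
  have hrep : ∀ θ : ℝ, ∃ n : ℤ, ∃ r ∈ Ioc (-Real.pi) Real.pi, θ = r + n * (2 * Real.pi) := by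
    intro θ
    refine ⟨toIocDiv Real.two_pi_pos (-Real.pi) θ, toIocMod Real.two_pi_pos (-Real.pi) θ, ?_, ?_⟩
    · have := toIocMod_mem_Ioc Real.two_pi_pos (-Real.pi) θ
      rwa [show -Real.pi + 2 * Real.pi = Real.pi by ring] at this
    · rw [← zsmul_eq_mul]; exact (toIocMod_add_toIocDiv_zsmul _ _ _).symm
  have hpi := Real.pi_pos
  have hkpi : kernel (1 / 2) Real.pi = 0 := by rw [kernel_half]; simp
  have hmem : Real.pi ∈ Icc (-Real.pi) Real.pi := ⟨by linarith, le_rfl⟩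
  have hmem' : -Real.pi ∈ Icc (-Real.pi) Real.pi := ⟨le_rfl, by linarith⟩
  intro a b hab
  obtain ⟨m, r, hr, rfl⟩ := hrep a
  obtain ⟨n, s, hs, rfl⟩ := hrep b
  have hr' := Ioc_subset_Icc_self hr
  have hs' := Ioc_subset_Icc_self hs
  simp only [kernel_half_add_int_mul_two_pi]
  rcases lt_trichotomy m n with h | rfl | h
  · have h1 := monotoneOn_kernel_half_add_two_mul hr' hmem hr.2
    have h2 := monotoneOn_kernel_half_add_two_mul hmem' hs' hs.1.le
    simp only [kernel_half_neg, hkpi] at h1 h2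
    have h3 : (m : ℝ) + 1 ≤ n := by exact_mod_cast h
    nlinarith
  · have h1 := monotoneOn_kernel_half_add_two_mul hr' hs' (by linarith)
    simp only at h1
    linarith
  · have h3 : (n : ℝ) + 1 ≤ m := by exact_mod_cast h
    exfalso
    nlinarith [hr.1, hs.2]

lemma kernel_half_sub_mul_sub_ge (a b : ℝ) :
    -(2 * (a - b) ^ 2) ≤ (kernel (1 / 2) a - kernel (1 / 2) b) * (a - b) := by
  rcases le_total a b with h | h <;>
  · have := monotone_kernel_half_add_two_mul h
    simp only at this
    nlinarith

section Kuramoto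

variable {N : ℕ} {K : ℝ}

lemma norm_vectorField_half_le (hK : 0 < K) (Ω : Fin N → ℝ) (Θ : EuclideanSpace ℝ (Fin N)) :
    ‖vectorField (1 / 2) K Ω Θ‖ ≤ ∑ i, (|Ω i| + K) := by
  have h1 : ‖vectorField (1 / 2) K Ω Θ‖ ≤ ∑ i, |vectorField (1 / 2) K Ω Θ i| := by
    rw [EuclideanSpace.norm_eq]
    refine Real.sqrt_le_iff.2 ⟨Finset.sum_nonneg fun _ _ => abs_nonneg _, ?_⟩
    exact Finset.sum_sq_le_sq_sum_of_nonneg fun _ _ => abs_nonneg _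
  refine h1.trans (Finset.sum_le_sum fun i _ => ?_)
  have hN : (0 : ℝ) < N := by exact_mod_cast i.pos
  have h2 : |∑ j, kernel (1 / 2) (Θ j - Θ i)| ≤ N := by
    refine (Finset.abs_sum_le_sum_abs _ _).trans ?_
    refine (Finset.sum_le_sum fun j _ => abs_kernel_half_le _).trans ?_
    simp
  refine (abs_add_le _ _).trans ?_
  gcongr
  rw [abs_mul, abs_of_pos (div_pos hK hN)]
  calc K / N * |∑ j, kernel (1 / 2) (Θ j - Θ i)| ≤ K / N * N := by gcongr
    _ = K := by field_simp

/-- The Kuramoto field is one-sided Lipschitz. Since the kernel is odd, exchanging the roles of the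
two particles of a pair turns the inner product into a sum over pairs of
`-(h a - h b) * (a - b) / 2`, with `a`, `b` the phase differences of the pair in the two
configurations; each of these terms is at most `(a - b) ^ 2`. -/
lemma inner_vectorField_half_sub_le (hK : 0 < K) (Ω : Fin N → ℝ)
    (x y : EuclideanSpace ℝ (Fin N)) :
    ⟪vectorField (1 / 2) K Ω x - vectorField (1 / 2) K Ω y, x - y⟫ ≤ 4 * K * ‖x - y‖ ^ 2 := by
  set k := kernel (1 / 2) with hk
  set S := ∑ i, ∑ j, (k (x j - x i) - k (y j - y i)) * (x i - y i) with hS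
  have h1 : ⟪vectorField (1 / 2) K Ω x - vectorField (1 / 2) K Ω y, x - y⟫ = K / N * S := by
    simp only [PiLp.inner_apply, vectorField, PiLp.sub_apply, hS, Finset.mul_sum,
      RCLike.inner_apply, conj_trivial, ← hk]
    refine Finset.sum_congr rfl fun i _ => ?_
    rw [add_sub_add_left_eq_sub, ← Finset.sum_sub_distrib, Finset.mul_sum]
    exact Finset.sum_congr rfl fun j _ => by ring
  have h2 : S = ∑ i, ∑ j, (k (x j - x i) - k (y j - y i)) * -(x j - y j) := by
    rw [hS, Finset.sum_comm]
    refine Finset.sum_congr rfl fun i _ => Finset.sum_congr rfl fun j _ => ?_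
    rw [← neg_sub (x j) (x i), ← neg_sub (y j) (y i), hk, kernel_half_neg, kernel_half_neg]
    ring
  have hnorm : ‖x - y‖ ^ 2 = ∑ i, (x i - y i) ^ 2 := by
    simp [EuclideanSpace.norm_sq_eq]
  have h3 : 2 * S ≤ ∑ i : Fin N, ∑ j : Fin N, (4 * (x j - y j) ^ 2 + 4 * (x i - y i) ^ 2) := by
    rw [two_mul]
    nth_rewrite 2 [h2]
    rw [hS, ← Finset.sum_add_distrib]
    refine Finset.sum_le_sum fun i _ => ?_
    rw [← Finset.sum_add_distrib]
    refine Finset.sum_le_sum fun j _ => ?_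
    have := kernel_half_sub_mul_sub_ge (x j - x i) (y j - y i)
    simp only [← hk] at this
    nlinarith [sq_nonneg ((x j - y j) + (x i - y i))]
  have h4 : ∑ i : Fin N, ∑ j : Fin N, (4 * (x j - y j) ^ 2 + 4 * (x i - y i) ^ 2)
      = 8 * N * ‖x - y‖ ^ 2 := by
    simp only [Finset.sum_add_distrib, ← Finset.mul_sum, ← hnorm, Finset.sum_const,
      Finset.card_univ, Fintype.card_fin, nsmul_eq_mul]
    ring
  rw [h1]
  rcases Nat.eq_zero_or_pos N with rfl | hN
  · simp [hnorm]
  have hN' : (0 : ℝ) < N := by exact_mod_cast hN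
  calc K / N * S ≤ K / N * (4 * N * ‖x - y‖ ^ 2) := by
        gcongr
        linarith
    _ = 4 * K * ‖x - y‖ ^ 2 := by field_simp

end Kuramoto

end SingularKuramoto

theorem mainTheorem3 (N : ℕ) (hN : 1 ≤ N) (K : ℝ) (hK : 0 < K) (Ω : Fin N → ℝ)
    (Θ₀ : EuclideanSpace ℝ (Fin N)) :
    ∃ Θ : ℝ → EuclideanSpace ℝ (Fin N),
      (SingularKuramoto.IsFilippovSolutionOn
          (SingularKuramoto.vectorField (1 / 2) K Ω) Θ (Set.Ici 0) ∧ Θ 0 = Θ₀) ∧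
      (∀ Ψ : ℝ → EuclideanSpace ℝ (Fin N),
        SingularKuramoto.IsFilippovSolutionOn
            (SingularKuramoto.vectorField (1 / 2) K Ω) Ψ (Set.Ici 0) → Ψ 0 = Θ₀ →
          ∀ t : ℝ, 0 ≤ t → Ψ t = Θ t) ∧
      (∀ (T : ℝ) (Ψ : ℝ → EuclideanSpace ℝ (Fin N)),
        SingularKuramoto.IsFilippovSolutionOn
            (SingularKuramoto.vectorField (1 / 2) K Ω) Ψ (Set.Icc 0 T) → Ψ 0 = Θ₀ →
          ∀ t ∈ Set.Icc 0 T, Ψ t = Θ t) := by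
  have hM := SingularKuramoto.norm_vectorField_half_le hK Ω
  have hF := SingularKuramoto.inner_vectorField_half_sub_le hK Ω
  have hL : 0 ≤ 4 * K := by positivity
  obtain ⟨x, hx, hx0⟩ := SingularKuramoto.exists_isFilippovSolutionOn_Ici hL hM hF Θ₀
  have huniq : ∀ y : ℝ → EuclideanSpace ℝ (Fin N), y 0 = Θ₀ → ∀ t, 0 ≤ t →
      SingularKuramoto.IsFilippovSolutionOn (SingularKuramoto.vectorField (1 / 2) K Ω) y
        (Set.Icc 0 t) → y t = x t := fun y hy0 t ht hy =>
    SingularKuramoto.eq_of_isFilippovSolutionOn_Icc hL hM hF ht hy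
      (hx.mono Set.Icc_subset_Ici_self) (hy0.trans hx0.symm)
  exact ⟨x, ⟨hx, hx0⟩,
    fun y hy hy0 t ht => huniq y hy0 t ht (hy.mono Set.Icc_subset_Ici_self),
    fun T y hy hy0 t ht => huniq y hy0 t ht.1 (hy.mono (Set.Icc_subset_Icc_right ht.2))⟩
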